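/- Let $\mathbb{F}_q$ be a finite field with $q$ elements and characteristic $p$, and let $\phi$ be the quadratic character of $\mathbb{F}_q^*$, extended by $\phi(0)=0$. Put $$\Sigma=\sum_{j,x\in\mathbb{F}_q^*}\phi(jx)\,\phi(1-x)\,\phi\bigl(x(j+1)^2+(j-1)^2\bigr).$$ (i) If $q\equiv 7\pmod 8$, then $\Sigma=2q$. (ii) If $q\equiv 3\pmod 8$, then there is a unique pair $(U,V)$ of positive integers with $p\nmid U$ and $q^2=U^2+2V^2$; there is a unique integer $u$ such that $q^2=u^2+2v^2$ for some integer $v$, $p\nmid u$ and $u\equiv -1\pmod 8$ (so $|u|=U$); and $\Sigma=2u$. (iii) In particular, if $q=p\equiv 3\pmod 8$, then there are integers $a_8,b_8$ with $p=a_8^2+2b_8^2$, and for any such integers $\Sigma=4a_8^2-2p$. -/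

import Mathlib

/-- The double character sum `∑_{j, x ∈ F^*} φ(jx) φ(1-x) φ(x(j+1)² + (j-1)²)` over a finite field,
where `φ` is the quadratic character, extended by `φ(0) = 0`. -/
def quadraticDoubleSum (F : Type*) [Field F] [Fintype F] [DecidableEq F] : ℤ :=
  ∑ j : Fˣ, ∑ x : Fˣ,
    quadraticChar F ((j : F) * (x : F)) * quadraticChar F (1 - (x : F)) *
      quadraticChar F ((x : F) * ((j : F) + 1) ^ 2 + ((j : F) - 1) ^ 2)

open Finset

/-! Since `q ≡ 3 mod 4`, `K = F(i)` is a field with `q²` elements. Let ψ be its quadratic character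
and `S = ∑_w ψ(w) ψ(1 - w⁴)` over `K`. As ψ is φ composed with the norm, `S` is in coordinates `w =
a + bi` a sum over `a²`, `b²`; counting square roots turns it into `2Σ`.

Let χ have order 8 on `K`, so ψ = χ⁴. Then `S` is the sum of the Jacobi sums `J_k = J(χ^k, χ⁴)`, `k
= 1, 3, 5, 7`. The `q`-Frobenius gives `J_k = J_{qk}`, and `J_k J_{-k} = q²`. Summing along a
primitive root gives `S = 4U` with `U ≡ -1 mod 4`, so `Σ = 2U`.

If `q ≡ 7 mod 8`, each `J_k` is `±q`, so `U` is `q`, `0` or `-q`, and the congruence selects `q`. If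
`q ≡ 3 mod 8`, `J_1` and `J_7` are `U ± V√-2`, so `q² = U² + 2V²`. Modulo `p`, `S` is a multiple of
a binomial coefficient that Lucas' theorem shows to be nonzero, so `p ∤ U`. Coprimality then forces
`q = A² + 2B²`, `U = A² - 2B²`, whence `U ≡ -1 mod 8`; such a `U` is unique. -/

theorem ringChar_ne_two_of_card_mod_four {F : Type*} [Field F] [Fintype F]
    (h : Fintype.card F % 4 = 3) : ringChar F ≠ 2 := by
  intro h2
  have := FiniteField.even_card_of_char_two h2
  omega

theorem two_ne_zero_of_card_mod_four {F : Type*} [Field F] [Fintype F]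
    (h : Fintype.card F % 4 = 3) : (2 : F) ≠ 0 :=
  Ring.two_ne_zero (ringChar_ne_two_of_card_mod_four h)

theorem quadraticChar_neg_one_of_card_mod_four {F : Type*} [Field F] [Fintype F] [DecidableEq F]
    (h : Fintype.card F % 4 = 3) : quadraticChar F (-1) = -1 := by
  rw [quadraticChar_neg_one_iff_not_isSquare, FiniteField.isSquare_neg_one_iff]
  simpa using h

theorem quadraticChar_neg_of_card_mod_four {F : Type*} [Field F] [Fintype F] [DecidableEq F]
    (h : Fintype.card F % 4 = 3) (a : F) : quadraticChar F (-a) = - quadraticChar F a := by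
  rw [← neg_one_mul, map_mul, quadraticChar_neg_one_of_card_mod_four h, neg_one_mul]

/-! ### From the double sum to a sum over squares -/

theorem sum_comp_sq {F : Type*} [Field F] [Fintype F] [DecidableEq F] (hF : ringChar F ≠ 2)
    {R : Type*} [CommRing R] (G : F → R) :
    ∑ a : F, G (a ^ 2) = ∑ A : F, ((quadraticChar F A : R) + 1) * G A := by
  rw [← Finset.sum_fiberwise (s := univ) (g := fun a : F => a ^ 2)]
  refine Finset.sum_congr rfl fun A _ => ?_
  rw [Finset.sum_congr rfl (g := fun _ => G A)
    (fun a ha => by rw [(Finset.mem_filter.mp ha).2]), Finset.sum_const, nsmul_eq_mul]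
  congr 1
  have h := quadraticChar_card_sqrts hF A
  have h2 : ({x : F | x ^ 2 = A} : Set F).toFinset = univ.filter (fun x : F => x ^ 2 = A) := by
    ext; simp
  rw [h2] at h
  exact_mod_cast congrArg (fun z : ℤ => (z : R)) h

/-- Symmetrising over squares: only the mixed terms survive for an odd symmetric kernel. -/
theorem sum_sq_sq_of_odd {F : Type*} [Field F] [Fintype F] [DecidableEq F]
    (h : Fintype.card F % 4 = 3) (P : F → F → ℤ) (hsymm : ∀ A B, P A B = P B A)
    (hodd : ∀ A B, P (-A) (-B) = - P A B) :
    ∑ a : F, ∑ b : F, P (a ^ 2) (b ^ 2) = 2 * ∑ A : F, ∑ B : F, quadraticChar F A * P A B := by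
  have hF := ringChar_ne_two_of_card_mod_four h
  have e1 : ∑ a : F, ∑ b : F, P (a ^ 2) (b ^ 2) =
      ∑ A : F, ∑ B : F, (quadraticChar F A + 1) * ((quadraticChar F B + 1) * P A B) := by
    have e (a : F) : ∑ b : F, P a (b ^ 2) = ∑ B : F, (quadraticChar F B + 1) * P a B := by
      simpa using sum_comp_sq hF (fun B => P a B)
    simp_rw [e]
    have := sum_comp_sq hF (fun A => ∑ B : F, (quadraticChar F B + 1) * P A B)
    simpa [Finset.mul_sum] using this
  have odd_zero (Q : F → F → ℤ) (hQ : ∀ A B, Q (-A) (-B) = - Q A B) :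
      ∑ A : F, ∑ B : F, Q A B = 0 := by
    have : ∑ A : F, ∑ B : F, Q A B = - ∑ A : F, ∑ B : F, Q A B := by
      conv_lhs => rw [← Equiv.sum_comp (Equiv.neg F)]
      rw [← Finset.sum_neg_distrib]
      refine Finset.sum_congr rfl fun A _ => ?_
      rw [← Equiv.sum_comp (Equiv.neg F), ← Finset.sum_neg_distrib]
      exact Finset.sum_congr rfl fun B _ => hQ A B
    omega
  have h1 := odd_zero P hodd
  have h2 := odd_zero (fun A B => quadraticChar F A * quadraticChar F B * P A B) (fun A B => by
    simp only [quadraticChar_neg_of_card_mod_four h, hodd]; ring)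
  have h3 : ∑ A : F, ∑ B : F, quadraticChar F B * P A B =
      ∑ A : F, ∑ B : F, quadraticChar F A * P A B := by
    rw [Finset.sum_comm]
    simp_rw [hsymm]
  rw [e1, two_mul]
  nth_rewrite 1 [← h3]
  rw [← add_zero (_ + _), ← h1, ← add_zero (_ + _), ← h2]
  simp_rw [← Finset.sum_add_distrib]
  exact Finset.sum_congr rfl fun A _ => Finset.sum_congr rfl fun B _ => by ring

theorem sum_units_eq_sum {F : Type*} [Field F] [Fintype F] [DecidableEq F] {R : Type*}
    [AddCommMonoid R] (f : F → R) (h0 : f 0 = 0) : ∑ x : Fˣ, f x = ∑ x : F, f x := by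
  rw [← Finset.add_sum_erase univ f (mem_univ (0 : F)), h0, zero_add]
  refine Finset.sum_bij (fun x _ => (x : F)) (by simp) (by simp [Units.ext_iff]) ?_ (by simp)
  intro b hb
  exact ⟨Units.mk0 b (by simpa using hb), by simp⟩

/-- The quartic factors as a difference of squares, and `A = (r + 1)² x / 4` matches the two sides
term by term. At `r = -1` this substitution degenerates, and both sides are computed to be `-1`. -/
theorem quadraticDoubleSum_inner {F : Type*} [Field F] [Fintype F] [DecidableEq F]
    (h : Fintype.card F % 4 = 3) (r : F) :
    ∑ A : F, quadraticChar F A *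
        (quadraticChar F r * quadraticChar F ((r ^ 2 + 1) ^ 2 - 4 * (2 * A - r) ^ 2)) =
      ∑ x : F, quadraticChar F (r * x) * quadraticChar F (1 - x) *
        quadraticChar F (x * (r + 1) ^ 2 + (r - 1) ^ 2) := by
  have h2 := two_ne_zero_of_card_mod_four h
  have hF := ringChar_ne_two_of_card_mod_four h
  have h4 : (4 : F) ≠ 0 := by
    have : (4 : F) = 2 * 2 := by norm_num
    rw [this]; exact mul_ne_zero h2 h2
  have q4 : quadraticChar F 4 = 1 := by
    have : (4 : F) = 2 ^ 2 := by norm_num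
    rw [this, quadraticChar_sq_one' h2]
  have hfac (A : F) : (r ^ 2 + 1) ^ 2 - 4 * (2 * A - r) ^ 2 =
      ((r + 1) ^ 2 - 4 * A) * ((r - 1) ^ 2 + 4 * A) := by ring
  simp_rw [hfac]
  by_cases hr : r + 1 = 0
  · have hr' : r = -1 := eq_neg_of_add_eq_zero_left hr
    subst hr'
    have t1 (A : F) : quadraticChar F A * (quadraticChar F (-1) *
        quadraticChar F (((-1 + 1) ^ 2 - 4 * A) * ((-1 - 1) ^ 2 + 4 * A))) =
        if A = 0 then 0 else quadraticChar F (1 + A) := by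
      split_ifs with hA
      · simp [hA]
      · have : (((-1 + 1) ^ 2 - 4 * A) * ((-1 - 1) ^ 2 + 4 * A)) = -1 * (4 ^ 2 * (A * (1 + A))) := by
          ring
        rw [this]
        simp only [map_mul, quadraticChar_sq_one' h4, quadraticChar_neg_one_of_card_mod_four h]
        have := quadraticChar_sq_one hA
        linear_combination (quadraticChar F (1 + A)) * this
    simp_rw [t1]
    have s1 : ∑ A : F, (if A = 0 then 0 else quadraticChar F (1 + A)) = -1 := by
      have : ∑ A : F, quadraticChar F (1 + A) = 0 := by
        exact (Equiv.sum_comp (Equiv.addLeft (1 : F)) (fun x => quadraticChar F x)).trans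
          (quadraticChar_sum_zero hF)
      rw [← Finset.add_sum_erase univ _ (mem_univ (0 : F))] at this ⊢
      rw [Finset.sum_congr rfl (g := fun A => quadraticChar F (1 + A))
        (fun A hA => by simp [(Finset.mem_erase.mp hA).1])]
      simp at this ⊢
      omega
    rw [s1]
    -- substitute `x = 1 / (1 + A)` on the other side
    have t3 (x : F) (hx : x ≠ 0) : quadraticChar F (-1 * x) * quadraticChar F (1 - x) *
        quadraticChar F (x * (-1 + 1) ^ 2 + (-1 - 1) ^ 2) = - quadraticChar F (x⁻¹ - 1) := by
      have e1 : (x * (-1 + 1) ^ 2 + (-1 - 1) ^ 2) = 4 := by ring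
      have e2 : 1 - x = x * (x⁻¹ - 1) := by field_simp
      rw [e1, e2, q4]
      simp only [map_mul, quadraticChar_neg_one_of_card_mod_four h]
      have := quadraticChar_sq_one hx
      linear_combination (-quadraticChar F (x⁻¹ - 1)) * this
    -- With `0⁻¹ = 0` inversion permutes all of `F`; the spurious term at `x = 0` is `φ(-1) = -1`.
    have s2 : ∑ x : F, quadraticChar F (x⁻¹ - 1) = 0 := by
      exact (Equiv.sum_comp (Equiv.inv F) (fun x => quadraticChar F (x - 1))).trans
        ((Equiv.sum_comp (Equiv.subRight (1 : F)) (fun x => quadraticChar F x)).trans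
          (quadraticChar_sum_zero hF))
    rw [← Finset.add_sum_erase univ _ (mem_univ (0 : F))] at s2 ⊢
    rw [Finset.sum_congr rfl (fun A hA => t3 A (Finset.mem_erase.mp hA).1)]
    rw [Finset.sum_neg_distrib]
    simp [quadraticChar_neg_one_of_card_mod_four h] at s2 ⊢
    omega
  · have hc : (r + 1) ^ 2 / 4 ≠ 0 := div_ne_zero (pow_ne_zero 2 hr) h4
    rw [← Equiv.sum_comp (Equiv.mulLeft₀ _ hc)]
    refine Finset.sum_congr rfl fun x _ => ?_
    change quadraticChar F ((r + 1) ^ 2 / 4 * x) * (quadraticChar F r * quadraticChar F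
      (((r + 1) ^ 2 - 4 * ((r + 1) ^ 2 / 4 * x)) * ((r - 1) ^ 2 + 4 * ((r + 1) ^ 2 / 4 * x)))) = _
    have e1 : ((r + 1) ^ 2 - 4 * ((r + 1) ^ 2 / 4 * x)) = (r + 1) ^ 2 * (1 - x) := by field_simp
    have e2 : (r - 1) ^ 2 + 4 * ((r + 1) ^ 2 / 4 * x) = x * (r + 1) ^ 2 + (r - 1) ^ 2 := by
      field_simp; ring
    have e3 : quadraticChar F ((r + 1) ^ 2 / 4 * x) = quadraticChar F x := by
      have : (r + 1) ^ 2 / 4 = ((r + 1) / 2) ^ 2 := by rw [div_pow]; norm_num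
      rw [this, map_mul, quadraticChar_sq_one' (div_ne_zero hr h2), one_mul]
    rw [e1, e2, e3]
    simp only [map_mul, quadraticChar_sq_one' hr]
    ring

theorem sum_norm_kernel_eq_two_mul_quadraticDoubleSum {F : Type*} [Field F] [Fintype F]
    [DecidableEq F] (h : Fintype.card F % 4 = 3) :
    ∑ a : F, ∑ b : F, quadraticChar F (a ^ 2 + b ^ 2) *
        quadraticChar F (((a ^ 2 + b ^ 2) ^ 2 + 1) ^ 2 - 4 * (a ^ 2 - b ^ 2) ^ 2) =
      2 * quadraticDoubleSum F := by
  rw [sum_sq_sq_of_odd h (fun A B => quadraticChar F (A + B) *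
        quadraticChar F (((A + B) ^ 2 + 1) ^ 2 - 4 * (A - B) ^ 2))
    (fun A B => by
      have e1 : A - B = -(B - A) := by ring
      rw [add_comm A B, e1, neg_sq])
    (fun A B => by
      have e1 : -A + -B = -(A + B) := by ring
      have e2 : -A - -B = -(A - B) := by ring
      rw [e1, e2, neg_sq, neg_sq, quadraticChar_neg_of_card_mod_four h]; ring)]
  congr 1
  unfold quadraticDoubleSum
  have hx (j : F) : ∑ x : Fˣ, quadraticChar F (j * (x : F)) * quadraticChar F (1 - (x : F)) *
      quadraticChar F ((x : F) * (j + 1) ^ 2 + (j - 1) ^ 2) =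
      ∑ x : F, quadraticChar F (j * x) * quadraticChar F (1 - x) *
      quadraticChar F (x * (j + 1) ^ 2 + (j - 1) ^ 2) :=
    sum_units_eq_sum (fun x => quadraticChar F (j * x) * quadraticChar F (1 - x) *
      quadraticChar F (x * (j + 1) ^ 2 + (j - 1) ^ 2)) (by simp)
  simp_rw [hx]
  rw [sum_units_eq_sum (fun j => ∑ x : F, quadraticChar F (j * x) * quadraticChar F (1 - x) *
      quadraticChar F (x * (j + 1) ^ 2 + (j - 1) ^ 2)) (by simp)]
  simp_rw [← quadraticDoubleSum_inner h]
  rw [Finset.sum_comm (s := univ) (t := univ) (γ := F) (α := F)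
    (f := fun r A => quadraticChar F A *
        (quadraticChar F r * quadraticChar F ((r ^ 2 + 1) ^ 2 - 4 * (2 * A - r) ^ 2)))]
  refine Finset.sum_congr rfl fun A _ => ?_
  -- Here `r = A + B`, so that `2A - r = A - B`.
  rw [← Equiv.sum_comp (Equiv.addLeft A) (fun r => quadraticChar F A *
        (quadraticChar F r * quadraticChar F ((r ^ 2 + 1) ^ 2 - 4 * (2 * A - r) ^ 2)))]
  refine Finset.sum_congr rfl fun B _ => ?_
  have : 2 * A - (A + B) = A - B := by ring
  simp only [Equiv.coe_addLeft, this]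

/-! ### The quadratic extension and its norm -/

/-- The quadratic extension `F(i)` of a field in which `-1` is not a square. -/
abbrev GaussExt (F : Type*) [Field F] := QuadraticAlgebra F (-1 : F) 0

instance {F : Type*} [Field F] [Fintype F] : Fintype (GaussExt F) :=
  Fintype.ofEquiv (F × F) (QuadraticAlgebra.equivProd (-1 : F) 0).symm

theorem card_gaussExt (F : Type*) [Field F] [Fintype F] :
    Fintype.card (GaussExt F) = Fintype.card F ^ 2 := by
  rw [Fintype.card_congr (QuadraticAlgebra.equivProd (-1 : F) 0), Fintype.card_prod, sq]

theorem fact_gaussExt {F : Type*} [Field F] [Fintype F] (h : Fintype.card F % 4 = 3) :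
    Fact (∀ r : F, r ^ 2 ≠ (-1 : F) + 0 * r) := by
  refine ⟨fun r hr => ?_⟩
  have : IsSquare (-1 : F) := ⟨r, by rw [← sq, hr]; ring⟩
  rw [FiniteField.isSquare_neg_one_iff] at this
  exact this h

theorem charP_gaussExt {F : Type*} [Field F] (p : ℕ) [CharP F p] : CharP (GaussExt F) p :=
  charP_of_injective_algebraMap (algebraMap F (GaussExt F)).injective p

/-- The `q`-power map is additive, fixes `F` and sends `i` to `i³ = -i`. -/
theorem gaussExt_pow_card {F : Type*} [Field F] [Fintype F] (h : Fintype.card F % 4 = 3)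
    (w : GaussExt F) : w ^ Fintype.card F = star w := by
  obtain ⟨p, hchar, n, hp, hc⟩ := FiniteField.card' F
  have : Fact p.Prime := ⟨hp⟩
  have := charP_gaussExt (F := F) p
  have hw : w = algebraMap F (GaussExt F) w.re +
      algebraMap F (GaussExt F) w.im * QuadraticAlgebra.omega := by
    ext <;> simp
  have ho : (QuadraticAlgebra.omega : GaussExt F) ^ Fintype.card F = - QuadraticAlgebra.omega := by
    have h2 : (QuadraticAlgebra.omega : GaussExt F) ^ 2 = -1 := by
      rw [sq]; ext <;> simp [QuadraticAlgebra.re_one, QuadraticAlgebra.im_one]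
    have h4 : (QuadraticAlgebra.omega : GaussExt F) ^ 4 = 1 := by
      rw [show 4 = 2 * 2 from rfl, pow_mul, h2]; ring
    rw [← Nat.div_add_mod (Fintype.card F) 4, h, pow_add, pow_mul, h4, one_pow, one_mul,
      pow_succ, h2]
    ring
  conv_lhs => rw [hw]
  have key : (algebraMap F (GaussExt F) w.re +
      algebraMap F (GaussExt F) w.im * QuadraticAlgebra.omega) ^ Fintype.card F =
      (algebraMap F (GaussExt F) w.re) ^ Fintype.card F +
      (algebraMap F (GaussExt F) w.im * QuadraticAlgebra.omega) ^ Fintype.card F := by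
    rw [hc]; exact add_pow_char_pow _ _ _ _
  rw [key, mul_pow, ho, ← map_pow, ← map_pow, FiniteField.pow_card, FiniteField.pow_card]
  ext <;> simp

theorem ringChar_gaussExt_ne_two {F : Type*} [Field F] [Fintype F] (h : Fintype.card F % 4 = 3)
    [Fact (∀ r : F, r ^ 2 ≠ (-1 : F) + 0 * r)] : ringChar (GaussExt F) ≠ 2 := by
  have := charP_gaussExt (F := F) (ringChar F)
  rw [ringChar.eq (GaussExt F) (ringChar F)]
  exact ringChar_ne_two_of_card_mod_four h

/-- The norm is `w^(q+1)`, so Euler's criterion in `F` and in `K` both give `w^((q²-1)/2)`. Values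
in `{0, 1, -1}` can be compared in `K`, whose characteristic is not 2. -/
theorem quadraticChar_gaussExt {F : Type*} [Field F] [Fintype F] [DecidableEq F]
    (h : Fintype.card F % 4 = 3) [Fact (∀ r : F, r ^ 2 ≠ (-1 : F) + 0 * r)]
    [DecidableEq (GaussExt F)] (w : GaussExt F) :
    quadraticChar (GaussExt F) w = quadraticChar F (QuadraticAlgebra.norm w) := by
  have hF := ringChar_ne_two_of_card_mod_four h
  have hK := ringChar_gaussExt_ne_two h
  have hcast : ((quadraticChar (GaussExt F) w : ℤ) : GaussExt F) =
      ((quadraticChar F (QuadraticAlgebra.norm w) : ℤ) : GaussExt F) := by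
    rw [quadraticChar_eq_pow_of_char_ne_two' hK,
      ← map_intCast (algebraMap F (GaussExt F)), quadraticChar_eq_pow_of_char_ne_two' hF,
      map_pow, QuadraticAlgebra.algebraMap_norm_eq_mul_star, ← gaussExt_pow_card h,
      ← pow_succ', ← pow_mul, card_gaussExt]
    congr 1
    obtain ⟨k, hk⟩ : ∃ k, Fintype.card F = 2 * k + 1 := ⟨Fintype.card F / 2, by omega⟩
    rw [hk]
    have e1 : (2 * k + 1) / 2 = k := by omega
    have e2 : (2 * k + 1) ^ 2 = 2 * ((2 * k + 1 + 1) * k) + 1 := by ring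
    rw [e1, e2]; omega
  exact (quadraticChar_isQuadratic (GaussExt F)).eq_of_eq_coe (quadraticChar_isQuadratic F) hK hcast

theorem sum_gaussExt_eq_two_mul_quadraticDoubleSum {F : Type*} [Field F] [Fintype F]
    [DecidableEq F] (h : Fintype.card F % 4 = 3) [Fact (∀ r : F, r ^ 2 ≠ (-1 : F) + 0 * r)]
    [DecidableEq (GaussExt F)] :
    ∑ w : GaussExt F, quadraticChar (GaussExt F) w * quadraticChar (GaussExt F) (1 - w ^ 4) =
      2 * quadraticDoubleSum F := by
  rw [← sum_norm_kernel_eq_two_mul_quadraticDoubleSum h, ← Fintype.sum_prod_type',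
    ← Equiv.sum_comp (QuadraticAlgebra.equivProd (-1 : F) 0)]
  refine Finset.sum_congr rfl fun w _ => ?_
  rw [quadraticChar_gaussExt h, quadraticChar_gaussExt h]
  congr 2
  · simp [QuadraticAlgebra.norm_def, QuadraticAlgebra.equivProd]; ring
  · simp [QuadraticAlgebra.norm_def, QuadraticAlgebra.equivProd, pow_succ, QuadraticAlgebra.re_one,
      QuadraticAlgebra.im_one]
    ring

/-! ### Octic Jacobi sums -/

section octic

theorem MulChar.apply_pow_eq_one_of_pow_eq_one {K : Type*} [Field K] {χ : MulChar K ℂ} {n : ℕ} (h : χ ^ n = 1) (hn : n ≠ 0) {w : K}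
    (hw : w ≠ 0) : χ w ^ n = 1 := by
  rw [← MulChar.pow_apply' χ hn, h, MulChar.one_apply hw.isUnit]

variable {K : Type*} [Field K] [Fintype K] [DecidableEq K] {χ : MulChar K ℂ}

/-- `χ⁴` is trivial on nonzero squares but not trivial; a point `a` where it differs from 1 is a
nonsquare, and multiplying by `a` turns any other nonsquare into a square. -/
theorem MulChar.pow_four_eq_quadraticChar (hχ : orderOf χ = 8) (w : K) :
    χ w ^ 4 = (quadraticChar K w : ℂ) := by
  have h8 : χ ^ 8 = 1 := hχ ▸ pow_orderOf_eq_one χ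
  have hsq (b : K) (hb : IsSquare b) (hb0 : b ≠ 0) : χ b ^ 4 = 1 := by
    obtain ⟨c, rfl⟩ := hb
    have hc : c ≠ 0 := by rintro rfl; simp at hb0
    rw [map_mul, ← sq, ← pow_mul]
    exact MulChar.apply_pow_eq_one_of_pow_eq_one h8 (by norm_num) hc
  by_cases hw : w = 0
  · simp [hw]
  by_cases hws : IsSquare w
  · rw [(quadraticChar_one_iff_isSquare hw).mpr hws, hsq w hws hw]; simp
  rw [quadraticChar_neg_one_iff_not_isSquare.mpr hws]
  have h4 : χ ^ 4 ≠ 1 := by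
    intro h
    have := orderOf_dvd_of_pow_eq_one h
    rw [hχ] at this
    norm_num at this
  obtain ⟨a, ha⟩ := MulChar.ne_one_iff.mp h4
  rw [MulChar.pow_apply' χ (by norm_num)] at ha
  have ha0 : (a : K) ≠ 0 := a.ne_zero
  have hans : ¬ IsSquare (a : K) := fun h => ha (hsq _ h ha0)
  have ham : χ a ^ 4 = -1 := by
    have : (χ a ^ 4) ^ 2 = 1 := by
      rw [← pow_mul]
      exact MulChar.apply_pow_eq_one_of_pow_eq_one h8 (by norm_num) ha0
    exact (sq_eq_sq_iff_eq_or_eq_neg.mp (this.trans (one_pow 2).symm)).resolve_left ha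
  have haw : IsSquare ((a : K) * w) := by
    rw [← quadraticChar_one_iff_isSquare (mul_ne_zero ha0 hw), map_mul,
      quadraticChar_neg_one_iff_not_isSquare.mpr hws,
      quadraticChar_neg_one_iff_not_isSquare.mpr hans]
    norm_num
  have := hsq _ haw (mul_ne_zero ha0 hw)
  rw [map_mul, mul_pow, ham] at this
  push_cast
  linear_combination -this

theorem jacobiSum_pow_four_eq (hχ : orderOf χ = 8) {k : ℕ} (hk : k ≠ 0) :
    jacobiSum (χ ^ k) (χ ^ 4) = ∑ y : K, χ y ^ k * (quadraticChar K (1 - y) : ℂ) := by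
  refine Finset.sum_congr rfl fun y _ => ?_
  rw [MulChar.pow_apply' χ hk, MulChar.pow_apply' χ (by norm_num),
    MulChar.pow_four_eq_quadraticChar hχ]

/-- The Jacobsthal sum of `w(1 - w⁴)` as a sum of the four odd octic Jacobi sums. -/
theorem sum_quadraticChar_octic (hK : ringChar K ≠ 2) (hχ : orderOf χ = 8) :
    ((∑ w : K, quadraticChar K w * quadraticChar K (1 - w ^ 4) : ℤ) : ℂ) =
      jacobiSum (χ ^ 1) (χ ^ 4) + jacobiSum (χ ^ 3) (χ ^ 4) + jacobiSum (χ ^ 5) (χ ^ 4) +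
        jacobiSum (χ ^ 7) (χ ^ 4) := by
  have hψ := MulChar.pow_four_eq_quadraticChar hχ
  have s1 : ((∑ w : K, quadraticChar K w * quadraticChar K (1 - w ^ 4) : ℤ) : ℂ) =
      ∑ w : K, (fun z => χ (z ^ 2) * (quadraticChar K (1 - z ^ 2) : ℂ)) (w ^ 2) := by
    push_cast
    refine Finset.sum_congr rfl fun w _ => ?_
    rw [← hψ w, ← map_pow, ← pow_mul]
  -- Substituting `z = w²` and then `y = z²` produces the weights `1 + χ(y)²` and `1 + χ(y)⁴`; their
  -- product with `χ(y)` is the sum of the four odd powers.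
  rw [s1, sum_comp_sq hK (fun z => χ (z ^ 2) * (quadraticChar K (1 - z ^ 2) : ℂ))]
  have s2 : ∑ z : K, ((quadraticChar K z : ℂ) + 1) *
      (χ (z ^ 2) * (quadraticChar K (1 - z ^ 2) : ℂ)) =
      ∑ z : K, (fun y => (χ y ^ 2 + 1) * (χ y * (quadraticChar K (1 - y) : ℂ))) (z ^ 2) := by
    refine Finset.sum_congr rfl fun z _ => ?_
    simp only [← hψ z, map_pow]
    ring
  rw [s2, sum_comp_sq hK (fun y => (χ y ^ 2 + 1) * (χ y * (quadraticChar K (1 - y) : ℂ))), jacobiSum_pow_four_eq hχ (by norm_num),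
    jacobiSum_pow_four_eq hχ (by norm_num), jacobiSum_pow_four_eq hχ (by norm_num),
    jacobiSum_pow_four_eq hχ (by norm_num), ← Finset.sum_add_distrib, ← Finset.sum_add_distrib,
    ← Finset.sum_add_distrib]
  refine Finset.sum_congr rfl fun y _ => ?_
  rw [← hψ y]
  ring

omit [DecidableEq K] in
theorem jacobiSum_pow_mul_jacobiSum_inv (hχ : orderOf χ = 8) {k l : ℕ}
    (hk : ¬ 4 ∣ k) (hkl : (k + l) % 8 = 0) :
    jacobiSum (χ ^ k) (χ ^ 4) * jacobiSum (χ ^ l) (χ ^ 4) = Fintype.card K := by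
  have h8 : χ ^ 8 = 1 := hχ ▸ pow_orderOf_eq_one χ
  have hne (m : ℕ) (hm : ¬ 8 ∣ m) : χ ^ m ≠ 1 := fun h => hm (hχ ▸ orderOf_dvd_of_pow_eq_one h)
  have e1 : (χ ^ k)⁻¹ = χ ^ l := by
    rw [inv_eq_iff_mul_eq_one, ← pow_add]
    obtain ⟨m, hm⟩ := Nat.dvd_of_mod_eq_zero hkl
    rw [hm, pow_mul, h8, one_pow]
  have e2 : (χ ^ 4)⁻¹ = χ ^ 4 := by
    rw [inv_eq_iff_mul_eq_one, ← pow_add, h8]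
  have h0 : ringChar ℂ ≠ ringChar K := by
    rw [ringChar.eq_zero]
    exact (CharP.ringChar_ne_zero_of_finite K).symm
  have := jacobiSum_mul_jacobiSum_inv h0 (hne k (by omega)) (hne 4 (by norm_num))
    (by rw [← pow_add]; exact hne _ (by omega))
  rwa [e1, e2] at this

/-- Reindex by `y ↦ y^q`: then `1 - y^q = (1 - y)^q`, and the odd power `q` does not change a
quadratic character value. -/
theorem jacobiSum_pow_eq_of_frobenius (hχ : orderOf χ = 8) {q : ℕ} (σ : K ≃+* K)
    (hσ : ∀ y, σ y = y ^ q) (hq : q % 2 = 1) {k l : ℕ} (hk : k ≠ 0) (hl : l ≠ 0)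
    (hkl : q * k % 8 = l % 8) :
    jacobiSum (χ ^ l) (χ ^ 4) = jacobiSum (χ ^ k) (χ ^ 4) := by
  have h8 : χ ^ 8 = 1 := hχ ▸ pow_orderOf_eq_one χ
  symm
  rw [jacobiSum_pow_four_eq hχ hk, jacobiSum_pow_four_eq hχ hl, ← Equiv.sum_comp σ.toEquiv]
  refine Finset.sum_congr rfl fun y _ => ?_
  have e1 : (1 : K) - σ y = (1 - y) ^ q := by rw [← hσ, map_sub, map_one]
  simp only [RingEquiv.toEquiv_eq_coe, EquivLike.coe_coe]
  rw [e1, hσ, map_pow, map_pow, ← pow_mul]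
  have e2 : quadraticChar K (1 - y) ^ q = quadraticChar K (1 - y) := by
    by_cases hy : 1 - y = 0
    · rw [hy, quadraticChar_zero, zero_pow (by omega)]
    · rw [← Nat.div_add_mod q 2, hq, pow_add, pow_mul, quadraticChar_sq_one hy]; simp
  rw [e2]
  congr 1
  by_cases hy : y = 0
  · have hqk : q * k ≠ 0 := Nat.mul_ne_zero (by omega) hk
    rw [hy, MulChar.map_zero, zero_pow hqk, zero_pow hl]
  · have h1 := MulChar.apply_pow_eq_one_of_pow_eq_one h8 (by norm_num) hy
    rw [← Nat.div_add_mod l 8, ← Nat.div_add_mod (q * k) 8, pow_add, pow_mul, h1, pow_add, pow_mul,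
      h1, hkl]
    simp

-- A primitive eighth root of unity satisfies `(ζ + ζ³)² = -2`, and for fourth roots of unity the
-- combination vanishes. This puts differences of Jacobi sums in `ℤ√-2` with no appeal to rings of
-- integers.
omit [Fintype K] in
theorem exists_int_octic_combination (hχ : orderOf χ = 8) (y : K) :
    ∃ s : ℤ, χ y + χ y ^ 3 - χ y ^ 5 - χ y ^ 7 = s * (2 * (Real.sqrt 2 * Complex.I)) := by
  have h8 : χ ^ 8 = 1 := hχ ▸ pow_orderOf_eq_one χ
  have hr : ((Real.sqrt 2 : ℝ) : ℂ) ^ 2 = 2 := by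
    rw [← Complex.ofReal_pow, Real.sq_sqrt (by norm_num)]; simp
  by_cases hy : y = 0
  · exact ⟨0, by subst hy; simp [MulChar.map_zero]⟩
  have h1 := MulChar.apply_pow_eq_one_of_pow_eq_one h8 (by norm_num) hy
  generalize χ y = x at h1
  have h4 : (x ^ 4 - 1) * (x ^ 4 + 1) = 0 := by linear_combination h1
  rcases mul_eq_zero.mp h4 with h | h
  · refine ⟨0, ?_⟩
    push_cast
    linear_combination (-x - x ^ 3) * h
  · set t := x + x ^ 3 - x ^ 5 - x ^ 7 with ht
    have hI := Complex.I_sq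
    have e : (t - 2 * (Real.sqrt 2 * Complex.I)) * (t + 2 * (Real.sqrt 2 * Complex.I)) = 0 := by
      have ht' : t = 2 * (x + x ^ 3) := by rw [ht]; linear_combination (-x - x ^ 3) * h
      have h2 : (2 * ((Real.sqrt 2 : ℂ) * Complex.I)) ^ 2 = -8 := by
        rw [mul_pow, mul_pow, hr, hI]; norm_num
      rw [ht']
      linear_combination (4 * x ^ 2 + 8) * h - h2
    rcases mul_eq_zero.mp e with h' | h'
    · exact ⟨1, by push_cast; linear_combination h'⟩
    · exact ⟨-1, by push_cast; linear_combination h'⟩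

theorem exists_norm_form_of_frobenius_three (hK : ringChar K ≠ 2) (hχ : orderOf χ = 8) {q : ℕ}
    (σ : K ≃+* K) (hσ : ∀ y, σ y = y ^ q) (hq : q % 8 = 3) (hcard : Fintype.card K = q ^ 2) {U : ℤ}
    (hU : ∑ w : K, quadraticChar K w * quadraticChar K (1 - w ^ 4) = 4 * U) :
    ∃ V : ℤ, (q : ℤ) ^ 2 = U ^ 2 + 2 * V ^ 2 := by
  choose s hs using exists_int_octic_combination (χ := χ) hχ
  have hr : ((Real.sqrt 2 : ℝ) : ℂ) ^ 2 = 2 := by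
    rw [← Complex.ofReal_pow, Real.sq_sqrt (by norm_num)]; simp
  have hsum := sum_quadraticChar_octic hK hχ
  have h31 := jacobiSum_pow_eq_of_frobenius hχ σ hσ (by omega) (k := 1) (l := 3) (by norm_num)
    (by norm_num) (by omega)
  have h57 := jacobiSum_pow_eq_of_frobenius hχ σ hσ (by omega) (k := 7) (l := 5) (by norm_num)
    (by norm_num) (by omega)
  have hmul := jacobiSum_pow_mul_jacobiSum_inv hχ (k := 1) (l := 7) (by norm_num) (by norm_num)
  have hdiff : jacobiSum (χ ^ 1) (χ ^ 4) + jacobiSum (χ ^ 3) (χ ^ 4) - jacobiSum (χ ^ 5) (χ ^ 4) -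
      jacobiSum (χ ^ 7) (χ ^ 4) =
      ((∑ y : K, s y * quadraticChar K (1 - y) : ℤ) : ℂ) * (2 * (Real.sqrt 2 * Complex.I)) := by
    rw [jacobiSum_pow_four_eq hχ (by norm_num),
      jacobiSum_pow_four_eq hχ (by norm_num), jacobiSum_pow_four_eq hχ (by norm_num),
      jacobiSum_pow_four_eq hχ (by norm_num), ← Finset.sum_add_distrib, ← Finset.sum_sub_distrib,
      ← Finset.sum_sub_distrib, Int.cast_sum, Finset.sum_mul]
    refine Finset.sum_congr rfl fun y _ => ?_
    push_cast
    linear_combination (quadraticChar K (1 - y) : ℂ) * hs y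
  rw [hU, h31, h57] at hsum
  rw [h31, h57] at hdiff
  rw [hcard] at hmul
  generalize jacobiSum (χ ^ 1) (χ ^ 4) = J at *
  generalize jacobiSum (χ ^ 7) (χ ^ 4) = J' at *
  generalize ∑ y : K, s y * quadraticChar K (1 - y) = W at *
  have hI := Complex.I_sq
  -- This is `4JJ' = (J + J')² - (J - J')²` with `J + J' = 2U` and `J - J' = W√-2`.
  have key : ((4 * U ^ 2 + 2 * W ^ 2 : ℤ) : ℂ) = ((4 * q ^ 2 : ℤ) : ℂ) := by
    push_cast at *
    have a1 : J + J' = 2 * U := by linear_combination -hsum / 2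
    have a2 : J - J' = W * (Real.sqrt 2 * Complex.I) := by linear_combination hdiff / 2
    have a3 : ((Real.sqrt 2 : ℂ) * Complex.I) ^ 2 = -2 := by rw [mul_pow, hr, hI]; norm_num
    linear_combination 4 * hmul - (J + J' + 2 * U) * a1 +
      (J - J' + W * (Real.sqrt 2 * Complex.I)) * a2 + (W : ℂ) ^ 2 * a3
  have key' : 4 * U ^ 2 + 2 * W ^ 2 = 4 * (q : ℤ) ^ 2 := by exact_mod_cast key
  have hW : Even W := by
    have : Even (W ^ 2) := ⟨(q : ℤ) ^ 2 - U ^ 2, by linarith⟩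
    exact (Int.even_pow.mp this).1
  obtain ⟨V, rfl⟩ := hW
  exact ⟨V, by nlinarith⟩

theorem sum_quadraticChar_octic_of_frobenius_seven (hK : ringChar K ≠ 2) (hχ : orderOf χ = 8)
    {q : ℕ} (σ : K ≃+* K) (hσ : ∀ y, σ y = y ^ q) (hq : q % 8 = 7)
    (hcard : Fintype.card K = q ^ 2) {U : ℤ}
    (hU : ∑ w : K, quadraticChar K w * quadraticChar K (1 - w ^ 4) = 4 * U) :
    U = q ∨ U = 0 ∨ U = - q := by
  have hsum := sum_quadraticChar_octic hK hχ
  have h71 := jacobiSum_pow_eq_of_frobenius hχ σ hσ (by omega) (k := 1) (l := 7) (by norm_num)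
    (by norm_num) (by omega)
  have h53 := jacobiSum_pow_eq_of_frobenius hχ σ hσ (by omega) (k := 3) (l := 5) (by norm_num)
    (by norm_num) (by omega)
  have m1 := jacobiSum_pow_mul_jacobiSum_inv hχ (k := 1) (l := 7) (by norm_num) (by norm_num)
  have m3 := jacobiSum_pow_mul_jacobiSum_inv hχ (k := 3) (l := 5) (by norm_num) (by norm_num)
  rw [h71, hcard] at m1
  rw [h53, hcard] at m3
  rw [hU, h71, h53] at hsum
  push_cast at *
  have sq_cases {J : ℂ} (h : J * J = (q : ℂ) ^ 2) : J = q ∨ J = -q :=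
    sq_eq_sq_iff_eq_or_eq_neg.mp (by rw [sq, h])
  have fin {n : ℤ} (h : (U : ℂ) = n) : U = n := by exact_mod_cast h
  rcases sq_cases m1 with h1 | h1 <;> rcases sq_cases m3 with h3 | h3 <;> rw [h1, h3] at hsum
  · exact Or.inl (fin (by push_cast; linear_combination hsum / 4))
  · exact Or.inr (Or.inl (fin (by push_cast; linear_combination hsum / 4)))
  · exact Or.inr (Or.inl (fin (by push_cast; linear_combination hsum / 4)))
  · exact Or.inr (Or.inr (fin (by push_cast; linear_combination hsum / 4)))

end octic

/-! ### The congruence modulo 4 -/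

theorem sum_range_two_mul_modEq_four {n : ℕ} (hn : n ≠ 0) (a : ℕ → ℤ) (h0 : a 0 = 0)
    (hsymm : ∀ i j, i + j = 2 * n → a i = a j) (hodd : ∀ j, 0 < j → j < n → Odd (a j)) :
    ∑ j ∈ range (2 * n), a j ≡ a n + 2 * (n - 1) [ZMOD 4] := by
  obtain ⟨m, rfl⟩ := Nat.exists_eq_succ_of_ne_zero hn
  have e1 : ∑ j ∈ range m, a (m + 1 + (j + 1)) = ∑ j ∈ range m, a (j + 1) := by
    rw [← Finset.sum_range_reflect]
    refine Finset.sum_congr rfl fun j hj => hsymm _ _ ?_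
    have := Finset.mem_range.mp hj
    omega
  have e2 : ∑ j ∈ range (2 * (m + 1)), a j = a (m + 1) + 2 * ∑ j ∈ range m, a (j + 1) := by
    rw [two_mul (m + 1), Finset.sum_range_add, Finset.sum_range_succ', Finset.sum_range_succ', e1,
      h0]
    simp
    ring
  have e3 : ∑ j ∈ range m, a (j + 1) ≡ ∑ j ∈ range m, 1 [ZMOD 2] := by
    refine Int.ModEq.sum fun j hj => ?_
    have := Finset.mem_range.mp hj
    exact Int.odd_iff.mp (hodd (j + 1) (by omega) (by omega))
  simp only [Finset.sum_const, card_range, nsmul_eq_mul, mul_one] at e3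
  have e4 := e3.mul_left' (c := 2)
  rw [Nat.succ_eq_add_one, e2]
  push_cast
  simpa using e4.add_left (a (m + 1))

theorem sum_range_four_mul_of_periodic (f : ℕ → ℤ) (m : ℕ) (hf : ∀ j, f (m + j) = f j) :
    ∑ j ∈ range (4 * m), f j = 4 * ∑ j ∈ range m, f j := by
  have e : 4 * m = m + (m + (m + m)) := by ring
  rw [e]
  simp only [Finset.sum_range_add, hf]
  ring

/-- At `w = g^j`, `g` a primitive root, the term is `(-1)^j ψ(1 - g^(4j))`, of period `2n` in `j`;
this gives the factor 4. Since -1 is a square, the terms are symmetric under `j ↦ 2n - j`. Only the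
middle term `(-1)^n ψ(2) = (-1)^n` is unpaired, and `(-1)^n + 2(n - 1) ≡ -1 mod 4`. -/
theorem exists_sum_quadraticChar_octic_eq_four_mul {K : Type*} [Field K] [Fintype K]
    [DecidableEq K] {n : ℕ} (hcard : Fintype.card K = 8 * n + 1) :
    ∃ U : ℤ, ∑ w : K, quadraticChar K w * quadraticChar K (1 - w ^ 4) = 4 * U ∧
      U ≡ -1 [ZMOD 4] := by
  have hn : n ≠ 0 := by
    rintro rfl
    exact absurd (Fintype.one_lt_card (α := K)) (by omega)
  have hK : ringChar K ≠ 2 := by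
    intro h2
    have := FiniteField.even_card_of_char_two h2
    omega
  have hK2 := Ring.two_ne_zero hK
  obtain ⟨g, hg⟩ := IsCyclic.exists_generator (α := Kˣ)
  have hord : orderOf g = 8 * n := by
    rw [orderOf_eq_card_of_forall_mem_zpowers hg, Nat.card_eq_fintype_card, Fintype.card_units,
      hcard]
    rfl
  have hgψ : quadraticChar K g = -1 := by
    refine (quadraticChar_dichotomy g.ne_zero).resolve_left fun h1 => ?_
    obtain ⟨b, hb⟩ := quadraticChar_exists_neg_one' hK
    obtain ⟨k, rfl⟩ := (mem_powers_iff_mem_zpowers).mpr (hg b)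
    have hb' : quadraticChar K ((g : K) ^ k) = -1 := by
      rw [← Units.val_pow_eq_pow_val]; exact hb
    rw [map_pow, h1, one_pow] at hb'
    norm_num at hb'
  have hψn : quadraticChar K (-1) = 1 := by
    rw [quadraticChar_one_iff_isSquare (neg_ne_zero.mpr one_ne_zero),
      FiniteField.isSquare_neg_one_iff]
    omega
  have hψ2 : quadraticChar K 2 = 1 := by
    rw [quadraticChar_one_iff_isSquare hK2, FiniteField.isSquare_two_iff]
    omega
  have hg1 : (g : K) ^ (8 * n) = 1 := by
    rw [← hord, ← Units.val_pow_eq_pow_val, pow_orderOf_eq_one, Units.val_one]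
  have hgne (j : ℕ) (hj : 0 < j) (hj' : j < 8 * n) : (g : K) ^ j ≠ 1 := by
    intro h
    have h' : g ^ j = 1 := Units.ext (by simpa using h)
    have := Nat.le_of_dvd hj (orderOf_dvd_of_pow_eq_one h')
    omega
  set f : K → ℤ := fun w => quadraticChar K w * quadraticChar K (1 - w ^ 4) with hf
  set a : ℕ → ℤ := fun j => f ((g : K) ^ j) with ha
  have ha' (j : ℕ) : a j = (-1) ^ j * quadraticChar K (1 - (g : K) ^ (4 * j)) := by
    simp only [ha, hf, map_pow, hgψ, ← pow_mul, mul_comm]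
  have hsum : ∑ w : K, f w = ∑ j ∈ range (4 * (2 * n)), a j := by
    rw [← sum_units_eq_sum f (by simp [hf]), ← IsCyclic.image_range_orderOf hg, hord,
      Finset.sum_image, show 4 * (2 * n) = 8 * n by ring]
    · simp [ha]
    · intro i hi j hj hij
      simp only [coe_range, Set.mem_Iio, ← hord] at hi hj
      exact pow_injOn_Iio_orderOf hi hj hij
  refine ⟨∑ j ∈ range (2 * n), a j, ?_, ?_⟩
  · rw [hsum]
    refine sum_range_four_mul_of_periodic a (2 * n) fun j => ?_
    rw [ha', ha', mul_add, pow_add, pow_add, pow_mul, show 4 * (2 * n) = 8 * n by ring, hg1]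
    simp
  have hmain := sum_range_two_mul_modEq_four hn a (by simp [ha'])
    (fun i j hij => by
      have h1 : (g : K) ^ (4 * i) * (g : K) ^ (4 * j) = 1 := by
        rw [← pow_add, ← mul_add, hij, ← hg1]; ring_nf
      have h2 : (1 : K) - (g : K) ^ (4 * i) = -1 * (((g : K) ^ (2 * i)) ^ 2 * (1 - g ^ (4 * j))) := by
        rw [← pow_mul, show 2 * i * 2 = 4 * i by ring]
        linear_combination -h1
      have h3 : (-1 : ℤ) ^ i = (-1) ^ j := by
        have : Even (i + j) := ⟨n, by omega⟩
        rcases Nat.even_add.mp this with h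
        rcases Nat.even_or_odd i with hi | hi
        · rw [hi.neg_one_pow, (h.mp hi).neg_one_pow]
        · rw [hi.neg_one_pow, Odd.neg_one_pow]
          rw [← Nat.not_even_iff_odd] at hi ⊢
          exact fun hj => hi (h.mpr hj)
      rw [ha', ha', h2, h3]
      rw [map_mul (quadraticChar K) (-1), hψn, map_mul,
        quadraticChar_sq_one' (pow_ne_zero _ g.ne_zero), one_mul, one_mul])
    (fun j hj hjn => by
      have h1 : (1 : K) - (g : K) ^ (4 * j) ≠ 0 :=
        sub_ne_zero.mpr (hgne (4 * j) (by omega) (by omega)).symm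
      rw [ha']
      refine Odd.mul (Odd.pow (by decide)) ?_
      rcases quadraticChar_dichotomy h1 with h | h <;> rw [h] <;> decide)
  have han : a n = (-1) ^ n := by
    have h1 : (g : K) ^ (4 * n) = -1 := by
      have : ((g : K) ^ (4 * n)) ^ 2 = 1 ^ 2 := by
        rw [← pow_mul, one_pow, ← hg1]; ring_nf
      exact (sq_eq_sq_iff_eq_or_eq_neg.mp this).resolve_left (hgne _ (by omega) (by omega))
    rw [ha', h1, show (1 : K) - -1 = 2 by ring, hψ2, mul_one]
  refine hmain.trans ?_
  rw [han]
  rcases Nat.even_or_odd n with h | h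
  · rw [h.neg_one_pow]
    obtain ⟨k, rfl⟩ := h
    refine Int.modEq_iff_dvd.mpr ⟨-k, ?_⟩
    push_cast; ring
  · rw [h.neg_one_pow]
    obtain ⟨k, rfl⟩ := h
    refine Int.modEq_iff_dvd.mpr ⟨-k, ?_⟩
    push_cast; ring

/-! ### Nonvanishing modulo `p` -/

theorem sum_pow_eq_ite {K : Type*} [Field K] [Fintype K] [DecidableEq K] {i : ℕ} (hi : i ≠ 0) :
    ∑ w : K, w ^ i = if Fintype.card K - 1 ∣ i then -1 else 0 := by
  rw [← FiniteField.sum_pow_units, ← sum_units_eq_sum (fun w : K => w ^ i) (zero_pow hi)]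

/-- This is the character sum modulo `p`, by Euler's criterion. After binomial expansion only
exponents `4n + 4k` divisible by `8n` contribute, namely `k = n` and `k = 3n`, with equal
contributions. -/
theorem sum_octic_pow_eq {K : Type*} [Field K] [Fintype K] [DecidableEq K] {n : ℕ}
    (hcard : Fintype.card K = 8 * n + 1) :
    ∑ w : K, w ^ (4 * n) * (1 - w ^ 4) ^ (4 * n) = -2 * (-1) ^ n * ((4 * n).choose n : K) := by
  have hn : n ≠ 0 := by
    rintro rfl
    exact absurd (Fintype.one_lt_card (α := K)) (by omega)
  have e1 (w : K) : w ^ (4 * n) * (1 - w ^ 4) ^ (4 * n) =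
      ∑ k ∈ range (4 * n + 1), ((-1) ^ k * ((4 * n).choose k : K)) * w ^ (4 * n + 4 * k) := by
    rw [sub_eq_add_neg, add_comm, add_pow, Finset.mul_sum]
    refine Finset.sum_congr rfl fun k _ => ?_
    rw [neg_pow, one_pow, ← pow_mul, pow_add]
    ring
  simp_rw [e1]
  rw [Finset.sum_comm]
  have e2 (k : ℕ) (hk : k ∈ range (4 * n + 1)) :
      ∑ w : K, ((-1) ^ k * ((4 * n).choose k : K)) * w ^ (4 * n + 4 * k) =
      (if k = n then -((-1) ^ k * ((4 * n).choose k : K)) else 0) +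
        (if k = 3 * n then -((-1) ^ k * ((4 * n).choose k : K)) else 0) := by
    have hk' := Finset.mem_range.mp hk
    rw [← Finset.mul_sum, sum_pow_eq_ite (by omega), hcard, Nat.add_sub_cancel]
    have hiff : 8 * n ∣ 4 * n + 4 * k ↔ k = n ∨ k = 3 * n := by
      constructor
      · rintro ⟨m, hm⟩
        have hm3 : m < 3 := by
          by_contra h
          have : 8 * n * 3 ≤ 8 * n * m := Nat.mul_le_mul_left _ (by omega)
          omega
        interval_cases m <;> omega
      · rintro (rfl | rfl)
        · exact ⟨1, by ring⟩
        · exact ⟨2, by ring⟩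
    by_cases h1 : k = n
    · have h3 : ¬ k = 3 * n := by omega
      rw [if_pos (hiff.mpr (Or.inl h1)), if_pos h1, if_neg h3]; ring
    · by_cases h3 : k = 3 * n
      · rw [if_pos (hiff.mpr (Or.inr h3)), if_neg h1, if_pos h3]; ring
      · rw [if_neg (fun h => (hiff.mp h).elim h1 h3), if_neg h1, if_neg h3]; ring
  rw [Finset.sum_congr rfl e2, Finset.sum_add_distrib, Finset.sum_ite_eq', Finset.sum_ite_eq',
    if_pos (Finset.mem_range.mpr (by omega)), if_pos (Finset.mem_range.mpr (by omega)),
    ← Nat.choose_symm (n := 4 * n) (k := n) (by omega), show 4 * n - n = 3 * n by omega,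
    pow_mul]
  norm_num
  ring

theorem not_dvd_of_sum_quadraticChar_octic {K : Type*} [Field K] [Fintype K] [DecidableEq K]
    {p n : ℕ} [CharP K p] (hcard : Fintype.card K = 8 * n + 1) (hp : ¬ p ∣ (4 * n).choose n) {U : ℤ}
    (hU : ∑ w : K, quadraticChar K w * quadraticChar K (1 - w ^ 4) = 4 * U) : ¬ (p : ℤ) ∣ U := by
  intro hdvd
  have hK : ringChar K ≠ 2 := by
    intro h2
    have := FiniteField.even_card_of_char_two h2
    omega
  have hcast := congrArg (fun z : ℤ => (z : K)) hU
  simp only [Int.cast_sum, Int.cast_mul, quadraticChar_eq_pow_of_char_ne_two' hK,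
    show Fintype.card K / 2 = 4 * n by omega, (CharP.intCast_eq_zero_iff K p U).mpr hdvd,
    mul_zero, sum_octic_pow_eq hcard] at hcast
  have h2 : (-2 : K) ≠ 0 := neg_ne_zero.mpr (Ring.two_ne_zero hK)
  have h3 : (((4 * n).choose n : ℕ) : K) ≠ 0 := by
    rwa [Ne, CharP.cast_eq_zero_iff K p]
  exact mul_ne_zero (mul_ne_zero h2 (pow_ne_zero _ (by norm_num))) h3 hcast

theorem Nat.Prime.not_dvd_choose_mul_add {p N M c d : ℕ} (hp : p.Prime) (hc : c < p) (hd : d ≤ c)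
    (h : ¬ p ∣ N.choose M) : ¬ p ∣ (p * N + c).choose (p * M + d) := by
  have : Fact p.Prime := ⟨hp⟩
  have hL := Choose.choose_modEq_choose_mod_mul_choose_div_nat (p := p) (n := p * N + c)
    (k := p * M + d)
  have hdp : d < p := by omega
  rw [Nat.mul_add_mod, Nat.mul_add_mod, Nat.mod_eq_of_lt hc, Nat.mod_eq_of_lt hdp,
    Nat.mul_add_div hp.pos, Nat.mul_add_div hp.pos, Nat.div_eq_of_lt hc, Nat.div_eq_of_lt hdp,
    add_zero, add_zero] at hL
  rw [(Nat.ModEq.dvd_iff hL dvd_rfl), hp.dvd_mul, not_or]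
  refine ⟨fun h' => ?_, h⟩
  have h2 := (Nat.choose_mul_factorial_mul_factorial hd) ▸ (h'.mul_right d.factorial).mul_right
    (c - d).factorial
  exact absurd ((hp.dvd_factorial).mp h2) (by omega)

theorem Nat.Prime.exists_not_dvd_choose_of_mod_eight {p : ℕ} (hp : p.Prime) (h3 : p % 8 = 3)
    (r : ℕ) : ∃ n, (p ^ r) ^ 2 = 8 * n + 1 ∧ ¬ p ∣ (4 * n).choose n := by
  induction r with
  | zero => exact ⟨0, by simp, by simpa using hp.one_lt.ne'⟩
  | succ r ih =>
    obtain ⟨n, hn, hdvd⟩ := ih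
    obtain ⟨l, hl⟩ : ∃ l, p = 8 * l + 3 := ⟨p / 8, by omega⟩
    -- The new value is `p² n + (p² - 1)/8`: it appends the base-`p` digits `l`, `3l + 1` to `n`.
    -- Quadrupling, with one carry, appends `4l + 1`, `4l + 1` to `4n`, so Lucas applies digit by
    -- digit.
    refine ⟨p * (p * n + l) + (3 * l + 1), ?_, ?_⟩
    · have : (p ^ (r + 1)) ^ 2 = (p ^ r) ^ 2 * p ^ 2 := by ring
      rw [this, hn, hl]; ring
    · have e : 4 * (p * (p * n + l) + (3 * l + 1)) =
          p * (p * (4 * n) + (4 * l + 1)) + (4 * l + 1) := by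
        rw [hl]; ring
      rw [e]
      exact hp.not_dvd_choose_mul_add (by omega) (by omega)
        (hp.not_dvd_choose_mul_add (by omega) (by omega) hdvd)

/-! ### The form `u² + 2v²` -/

/-- Brahmagupta's identity gives `q⁴ = (uu' + 2vv')² + 2(uv' - u'v)²`; a nonzero multiple of `q²` in
the last square would be too large. -/
theorem sq_eq_sq_of_dvd_of_sq_add_two_mul_sq {q u v u' v' : ℤ} (hq : q ≠ 0)
    (h : q ^ 2 = u ^ 2 + 2 * v ^ 2) (h' : q ^ 2 = u' ^ 2 + 2 * v' ^ 2)
    (hdvd : q ^ 2 ∣ u * v' - u' * v) : u ^ 2 = u' ^ 2 := by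
  obtain ⟨t, ht⟩ := hdvd
  have hq2 : 0 < q ^ 2 := by positivity
  have key : q ^ 2 * q ^ 2 = (u * u' + 2 * v * v') ^ 2 + 2 * (q ^ 2 * t) ^ 2 := by
    rw [← ht]
    nth_rewrite 1 [h]
    rw [h']
    ring
  have ht0 : t = 0 := by
    by_contra h0
    have h1 : 1 ≤ t ^ 2 := by
      have : 0 < t ^ 2 := by positivity
      omega
    nlinarith [sq_nonneg (u * u' + 2 * v * v'), mul_pos hq2 hq2]
  rw [ht0, mul_zero] at ht
  have : q ^ 2 * (u ^ 2 - u' ^ 2) = 0 := by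
    linear_combination u ^ 2 * h' - u' ^ 2 * h + 2 * (u * v' + u' * v) * ht
  rcases mul_eq_zero.mp this with h0 | h0
  · exact absurd h0 hq2.ne'
  · linarith

/-- Up to sign, a power of an odd prime has at most one representation `q² = u² + 2v²` in which
`u` is prime to `p`. -/
theorem sq_eq_sq_of_sq_add_two_mul_sq {p r : ℕ} (hp : p.Prime) (hp2 : p ≠ 2)
    {u v u' v' : ℤ} (h : ((p : ℤ) ^ r) ^ 2 = u ^ 2 + 2 * v ^ 2)
    (h' : ((p : ℤ) ^ r) ^ 2 = u' ^ 2 + 2 * v' ^ 2) (hu : ¬ (p : ℤ) ∣ u) (hu' : ¬ (p : ℤ) ∣ u') :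
    u ^ 2 = u' ^ 2 := by
  have hpi : Prime (p : ℤ) := Nat.prime_iff_prime_int.mp hp
  have hq : (p : ℤ) ^ r ≠ 0 := pow_ne_zero _ hpi.ne_zero
  have hp2' : ¬ (p : ℤ) ∣ 2 := by
    intro h2
    have : p ∣ 2 := by exact_mod_cast h2
    exact hp2 ((Nat.prime_dvd_prime_iff_eq hp Nat.prime_two).mp this)
  by_cases hr : r = 0
  · subst hr
    refine sq_eq_sq_of_dvd_of_sq_add_two_mul_sq hq h h' (by simp)
  -- As `p` cannot divide both factors, the full power divides one of them; changing the sign of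
  -- `v'` exchanges them.
  have hprod : ((p : ℤ) ^ r) ^ 2 ∣ (u * v' - u' * v) * (u * v' + u' * v) :=
    ⟨v' ^ 2 - v ^ 2, by linear_combination v ^ 2 * h' - v' ^ 2 * h⟩
  by_cases hd : (p : ℤ) ∣ u * v' - u' * v
  · have hs : ¬ (p : ℤ) ∣ u * v' + u' * v := by
      intro hs
      have h1 : (p : ℤ) ∣ 2 * (u * v') := by
        have := dvd_add hd hs
        ring_nf at this ⊢
        exact this
      have hv' : (p : ℤ) ∣ v' :=
        (hpi.dvd_or_dvd ((hpi.dvd_or_dvd h1).resolve_left hp2')).resolve_left hu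
      have h2 : (p : ℤ) ∣ u' ^ 2 := by
        have e : u' ^ 2 = ((p : ℤ) ^ r) ^ 2 - 2 * v' ^ 2 := by linarith
        rw [e]
        exact dvd_sub (dvd_pow (dvd_pow_self _ hr) two_ne_zero)
          ((dvd_pow hv' two_ne_zero).mul_left 2)
      exact hu' (hpi.dvd_of_dvd_pow h2)
    rw [← pow_mul] at hprod
    have := hpi.pow_dvd_of_dvd_mul_right _ hs hprod
    rw [pow_mul] at this
    exact sq_eq_sq_of_dvd_of_sq_add_two_mul_sq hq h h' this
  · rw [← pow_mul] at hprod
    have := hpi.pow_dvd_of_dvd_mul_left _ hd hprod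
    rw [pow_mul] at this
    refine sq_eq_sq_of_dvd_of_sq_add_two_mul_sq (v' := -v') hq h (by rw [neg_sq]; exact h') ?_
    rw [show u * -v' - u' * v = -(u * v' + u' * v) by ring]
    exact this.neg_right

/-- With `q + U = 2s` and `q - U = 4t`, the equation says that `st` is a square. Here `s`, `t` are
coprime, and nonnegative because `|U| ≤ q`, so each is a square. -/
theorem exists_eq_sq_sub_two_mul_sq {q U V : ℤ} (hq0 : 0 ≤ q) (hq : q % 8 = 3) (hU : U % 4 = 3)
    (hcop : IsCoprime q U) (h : q ^ 2 = U ^ 2 + 2 * V ^ 2) :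
    ∃ A B : ℤ, q = A ^ 2 + 2 * B ^ 2 ∧ U = A ^ 2 - 2 * B ^ 2 := by
  obtain ⟨s, hs⟩ : ∃ s, q + U = 2 * s := ⟨(q + U) / 2, by omega⟩
  obtain ⟨t, ht⟩ : ∃ t, q - U = 4 * t := ⟨(q - U) / 4, by omega⟩
  have hV : V ^ 2 = 2 * (2 * (s * t)) := by
    have : 2 * V ^ 2 = 8 * (s * t) := by linear_combination -h + (q - U) * hs + 2 * s * ht
    linarith
  have hVe : Even V := by
    have : Even (V ^ 2) := ⟨2 * (s * t), by rw [hV]; ring⟩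
    exact (Int.even_pow.mp this).1
  obtain ⟨W, rfl⟩ := hVe
  have hst : s * t = W ^ 2 := by nlinarith
  have hle : |U| ≤ |q| := sq_le_sq.mp (by nlinarith [sq_nonneg (W + W)])
  rw [abs_of_nonneg hq0] at hle
  have hle' := abs_le.mp hle
  have hc : IsCoprime s t := by
    obtain ⟨x, y, hxy⟩ := hcop
    refine ⟨x + y, 2 * (x - y), ?_⟩
    have e1 : q = s + 2 * t := by omega
    have e2 : U = s - 2 * t := by omega
    rw [e1, e2] at hxy
    linear_combination hxy
  have nonneg_sq {a a0 : ℤ} (ha : 0 ≤ a) (h : a = a0 ^ 2 ∨ a = -a0 ^ 2) : a = a0 ^ 2 := by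
    rcases h with h | h
    · exact h
    · nlinarith [sq_nonneg a0]
  obtain ⟨A, hA⟩ := Int.sq_of_isCoprime hc hst
  obtain ⟨B, hB⟩ := Int.sq_of_isCoprime hc.symm (by rw [mul_comm]; exact hst)
  have hA' := nonneg_sq (by omega) hA
  have hB' := nonneg_sq (by omega) hB
  exact ⟨A, B, by rw [← hA', ← hB']; omega, by rw [← hA', ← hB']; omega⟩

theorem sq_sub_two_mul_sq_modEq {q A B : ℤ} (hq : q % 8 = 3) (h : q = A ^ 2 + 2 * B ^ 2) :
    A ^ 2 - 2 * B ^ 2 ≡ -1 [ZMOD 8] := by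
  have hsq (x : ℤ) : x ^ 2 % 8 = 0 ∨ x ^ 2 % 8 = 1 ∨ x ^ 2 % 8 = 4 := by
    have : x % 8 = 0 ∨ x % 8 = 1 ∨ x % 8 = 2 ∨ x % 8 = 3 ∨ x % 8 = 4 ∨ x % 8 = 5 ∨ x % 8 = 6 ∨
      x % 8 = 7 := by omega
    rcases this with h | h | h | h | h | h | h | h <;> simp [sq, Int.mul_emod, h]
  rw [Int.ModEq]
  have := hsq A
  have := hsq B
  omega

theorem not_dvd_sq_sub_two_mul_sq {p : ℕ} (hp : p.Prime) (hp2 : p ≠ 2) {a b : ℤ}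
    (h : (p : ℤ) = a ^ 2 + 2 * b ^ 2) : ¬ (p : ℤ) ∣ a ^ 2 - 2 * b ^ 2 := by
  intro hd
  have hpi : Prime (p : ℤ) := Nat.prime_iff_prime_int.mp hp
  have hp2' : ¬ (p : ℤ) ∣ 2 := by
    intro h2
    have : p ∣ 2 := by exact_mod_cast h2
    exact hp2 ((Nat.prime_dvd_prime_iff_eq hp Nat.prime_two).mp this)
  have hs : (p : ℤ) ∣ a ^ 2 + 2 * b ^ 2 := h ▸ dvd_rfl
  have ha : (p : ℤ) ∣ a := by
    have h1 : (p : ℤ) ∣ 2 * a ^ 2 := by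
      have := dvd_add hd hs
      ring_nf at this ⊢
      exact this
    exact hpi.dvd_of_dvd_pow ((hpi.dvd_or_dvd h1).resolve_left hp2')
  have hb : (p : ℤ) ∣ b := by
    have h1 : (p : ℤ) ∣ 2 * b ^ 2 := by
      have := dvd_sub hs (dvd_pow ha two_ne_zero)
      ring_nf at this ⊢
      exact this
    exact hpi.dvd_of_dvd_pow ((hpi.dvd_or_dvd h1).resolve_left hp2')
  obtain ⟨a', rfl⟩ := ha
  obtain ⟨b', rfl⟩ := hb
  refine hpi.not_dvd_one ⟨a' ^ 2 + 2 * b' ^ 2, mul_left_cancel₀ hpi.ne_zero ?_⟩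
  linear_combination h

/-! ### Evaluation of the double sum -/

theorem exists_mulChar_complex_orderOf_eight {K : Type*} [Field K] [Fintype K] {n : ℕ}
    (hcard : Fintype.card K = 8 * n + 1) : ∃ χ : MulChar K ℂ, orderOf χ = 8 :=
  MulChar.exists_mulChar_orderOf K ⟨n, by omega⟩ (Complex.isPrimitiveRoot_exp 8 (by norm_num))

theorem quadraticDoubleSum_of_card_mod_eight_eq_seven {F : Type*} [Field F] [Fintype F]
    [DecidableEq F] (hq : Fintype.card F % 8 = 7) :
    quadraticDoubleSum F = 2 * (Fintype.card F : ℤ) := by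
  have h4 : Fintype.card F % 4 = 3 := by omega
  have := fact_gaussExt h4
  classical
  obtain ⟨k, hk⟩ : ∃ k, Fintype.card F = 8 * k + 7 := ⟨Fintype.card F / 8, by omega⟩
  have hcard : Fintype.card (GaussExt F) = 8 * (8 * k ^ 2 + 14 * k + 6) + 1 := by
    rw [card_gaussExt, hk]; ring
  obtain ⟨U, hU, hU4⟩ := exists_sum_quadraticChar_octic_eq_four_mul hcard
  obtain ⟨χ, hχ⟩ := exists_mulChar_complex_orderOf_eight hcard
  have hcases := sum_quadraticChar_octic_of_frobenius_seven (ringChar_gaussExt_ne_two h4) hχ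
    starRingAut (fun y => (gaussExt_pow_card h4 y).symm) hq (card_gaussExt F) hU
  rw [sum_gaussExt_eq_two_mul_quadraticDoubleSum h4] at hU
  rw [Int.ModEq] at hU4
  omega

theorem exists_quadraticDoubleSum_eq_of_card_mod_eight_eq_three {F : Type*} [Field F] [Fintype F]
    [DecidableEq F] {p r : ℕ} [CharP F p] (hp : p.Prime) (hp8 : p % 8 = 3)
    (hcF : Fintype.card F = p ^ r) (hq : Fintype.card F % 8 = 3) :
    ∃ A B : ℤ, ((p : ℤ) ^ r) = A ^ 2 + 2 * B ^ 2 ∧ ¬ (p : ℤ) ∣ A ^ 2 - 2 * B ^ 2 ∧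
      quadraticDoubleSum F = 2 * (A ^ 2 - 2 * B ^ 2) := by
  have h4 : Fintype.card F % 4 = 3 := by omega
  have := fact_gaussExt h4
  have := charP_gaussExt (F := F) p
  classical
  obtain ⟨n, hn, hchoose⟩ := hp.exists_not_dvd_choose_of_mod_eight hp8 r
  have hcard : Fintype.card (GaussExt F) = 8 * n + 1 := by rw [card_gaussExt, hcF, hn]
  obtain ⟨U, hU, hU4⟩ := exists_sum_quadraticChar_octic_eq_four_mul hcard
  obtain ⟨χ, hχ⟩ := exists_mulChar_complex_orderOf_eight hcard
  obtain ⟨V, hV⟩ := exists_norm_form_of_frobenius_three (ringChar_gaussExt_ne_two h4) hχ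
    starRingAut (fun y => (gaussExt_pow_card h4 y).symm) hq (card_gaussExt F) hU
  have hpU := not_dvd_of_sum_quadraticChar_octic hcard hchoose hU
  rw [sum_gaussExt_eq_two_mul_quadraticDoubleSum h4] at hU
  have hcop : IsCoprime (Fintype.card F : ℤ) U := by
    rw [hcF]
    push_cast
    exact ((Prime.coprime_iff_not_dvd (Nat.prime_iff_prime_int.mp hp)).mpr hpU).pow_left
  rw [Int.ModEq] at hU4
  obtain ⟨A, B, hA, hB⟩ := exists_eq_sq_sub_two_mul_sq (by positivity) (by omega) (by omega) hcop hV
  refine ⟨A, B, by rw [← hA, hcF]; push_cast; rfl, hB ▸ hpU, ?_⟩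
  rw [← hB]
  omega

theorem Nat.mod_eight_of_pow_mod_eight {p r : ℕ} (h : p ^ r % 8 = 3) : p % 8 = 3 := by
  by_cases hp : p % 2 = 0
  · have hr : r ≠ 0 := by rintro rfl; simp at h
    have := Nat.even_pow.mpr ⟨Nat.even_iff.mpr hp, hr⟩
    have := Nat.even_iff.mp this
    omega
  have hpow : ∀ m : ℕ, p ^ m % 8 = 1 ∨ p ^ m % 8 = p % 8 := by
    intro m
    induction m with
    | zero => simp
    | succ m ih =>
      rw [pow_succ, Nat.mul_mod]
      rcases ih with ih | ih <;> rw [ih]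
      · right; simp
      · left
        have : p % 8 = 1 ∨ p % 8 = 3 ∨ p % 8 = 5 ∨ p % 8 = 7 := by omega
        rcases this with h | h | h | h <;> rw [h]
  have := hpow r
  omega

theorem theorem5p5 {F : Type*} [Field F] [Fintype F] [DecidableEq F] (p q : ℕ) [CharP F p]
    (hq : Fintype.card F = q) :
    (q ≡ 7 [MOD 8] → quadraticDoubleSum F = 2 * (q : ℤ)) ∧
    (q ≡ 3 [MOD 8] →
      (∃! w : ℕ × ℕ, 0 < w.1 ∧ 0 < w.2 ∧ ¬ p ∣ w.1 ∧ q ^ 2 = w.1 ^ 2 + 2 * w.2 ^ 2) ∧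
      (∃! u : ℤ, (∃ v : ℤ, (q : ℤ) ^ 2 = u ^ 2 + 2 * v ^ 2) ∧ ¬ (p : ℤ) ∣ u ∧
        u ≡ -1 [ZMOD 8]) ∧
      (∀ u v : ℤ, (q : ℤ) ^ 2 = u ^ 2 + 2 * v ^ 2 → ¬ (p : ℤ) ∣ u → u ≡ -1 [ZMOD 8] →
        quadraticDoubleSum F = 2 * u)) ∧
    (q = p → q ≡ 3 [MOD 8] →
      (∃ a b : ℤ, (p : ℤ) = a ^ 2 + 2 * b ^ 2) ∧
      (∀ a b : ℤ, (p : ℤ) = a ^ 2 + 2 * b ^ 2 →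
        quadraticDoubleSum F = 4 * a ^ 2 - 2 * (p : ℤ))) := by
  obtain ⟨⟨r, hr⟩, hp, hc⟩ := FiniteField.card F p
  simp only [PNat.mk_coe] at hc
  have hqr : q = p ^ r := hq ▸ hc
  have hqr' : (q : ℤ) = (p : ℤ) ^ r := by rw [hqr]; push_cast; rfl
  have hpi : Prime (p : ℤ) := Nat.prime_iff_prime_int.mp hp
  refine ⟨fun h7 => ?_, ?_⟩
  · rw [← hq]
    exact quadraticDoubleSum_of_card_mod_eight_eq_seven (by rw [hq]; exact h7)
  by_cases h3 : q % 8 = 3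
  swap
  · exact ⟨fun h => absurd h h3, fun _ h => absurd h h3⟩
  have hp8 : p % 8 = 3 := Nat.mod_eight_of_pow_mod_eight (r := r) (by rw [← hqr, h3])
  have hp2 : p ≠ 2 := by rintro rfl; norm_num at hp8
  have hq0 : (q : ℤ) ≠ 0 := by rw [hqr']; exact pow_ne_zero _ hpi.ne_zero
  obtain ⟨A, B, hAB, hpU, hS⟩ := exists_quadraticDoubleSum_eq_of_card_mod_eight_eq_three hp hp8 hc
    (hq.symm ▸ h3)
  have hq8 : (p : ℤ) ^ r % 8 = 3 := by rw [← hqr']; omega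
  have hU8 := sq_sub_two_mul_sq_modEq hq8 hAB
  -- The norm form of `(A + B√-2)² = (A² - 2B²) + 2AB√-2`.
  have hUV : (q : ℤ) ^ 2 = (A ^ 2 - 2 * B ^ 2) ^ 2 + 2 * (2 * A * B) ^ 2 := by
    rw [hqr', hAB]; ring
  have huniq (u v u' v' : ℤ) (h : (q : ℤ) ^ 2 = u ^ 2 + 2 * v ^ 2)
      (h' : (q : ℤ) ^ 2 = u' ^ 2 + 2 * v' ^ 2) (hu : ¬ (p : ℤ) ∣ u) (hu' : ¬ (p : ℤ) ∣ u') :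
      u ^ 2 = u' ^ 2 :=
    sq_eq_sq_of_sq_add_two_mul_sq hp hp2 (hqr' ▸ h) (hqr' ▸ h') hu hu'
  have huniq8 (u v : ℤ) (h : (q : ℤ) ^ 2 = u ^ 2 + 2 * v ^ 2) (hu : ¬ (p : ℤ) ∣ u)
      (hu8 : u ≡ -1 [ZMOD 8]) : u = A ^ 2 - 2 * B ^ 2 := by
    rcases sq_eq_sq_iff_eq_or_eq_neg.mp (huniq _ _ _ _ h hUV hu hpU) with h | h
    · exact h
    · rw [Int.ModEq] at hu8 hU8
      omega
  have hall (u v : ℤ) (h : (q : ℤ) ^ 2 = u ^ 2 + 2 * v ^ 2) (hu : ¬ (p : ℤ) ∣ u)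
      (hu8 : u ≡ -1 [ZMOD 8]) : quadraticDoubleSum F = 2 * u := by
    rw [hS, huniq8 u v h hu hu8]
  refine ⟨fun _ => ⟨?_, ⟨A ^ 2 - 2 * B ^ 2, ⟨⟨_, hUV⟩, hpU, hU8⟩, ?_⟩, hall⟩, ?_⟩
  -- If `V = 0` then `U² = q²`, so `p ∣ U`.
  · have hpV : 2 * A * B ≠ 0 := by
      intro h0
      rw [h0] at hUV
      refine hpU (hpi.dvd_of_dvd_pow (n := 2) ?_)
      have : (A ^ 2 - 2 * B ^ 2) ^ 2 = ((p : ℤ) ^ r) ^ 2 := by rw [← hqr', hUV]; ring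
      rw [this]
      exact dvd_pow (dvd_pow_self _ hr.ne') two_ne_zero
    have hU0 : A ^ 2 - 2 * B ^ 2 ≠ 0 := fun h0 => hpU (h0 ▸ dvd_zero _)
    refine ⟨((A ^ 2 - 2 * B ^ 2).natAbs, (2 * A * B).natAbs),
      ⟨Int.natAbs_pos.mpr hU0, Int.natAbs_pos.mpr hpV, ?_, ?_⟩, ?_⟩
    · rwa [← Int.natCast_dvd]
    · zify
      rw [sq_abs, sq_abs]
      exact hUV
    · rintro ⟨u, v⟩ ⟨-, -, hpu, huv⟩
      have huv' : (q : ℤ) ^ 2 = (u : ℤ) ^ 2 + 2 * (v : ℤ) ^ 2 := by exact_mod_cast huv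
      have hu2 := huniq _ _ _ _ huv' hUV (by exact_mod_cast hpu) hpU
      have hv2 : (v : ℤ) ^ 2 = (2 * A * B) ^ 2 := by linarith
      have e1 := Int.natAbs_eq_iff_sq_eq.mpr hu2
      have e2 := Int.natAbs_eq_iff_sq_eq.mpr hv2
      rw [Int.natAbs_natCast] at e1 e2
      rw [e1, e2]
  · rintro u ⟨⟨v, h⟩, hu, hu8⟩
    exact huniq8 u v h hu hu8
  · intro hqp _
    have hqp' : (q : ℤ) = p := by rw [hqp]
    refine ⟨⟨A, B, by rw [← hqp', hqr', hAB]⟩, fun a b hab => ?_⟩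
    rw [hall (a ^ 2 - 2 * b ^ 2) (2 * a * b) (by rw [hqp', hab]; ring)
      (not_dvd_sq_sub_two_mul_sq hp hp2 hab) (sq_sub_two_mul_sq_modEq (by omega) hab)]
    linarith
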